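/- For $d\in\mathbb N=\{1,2,\dots\}$ let $\|\cdot\|$ be the Euclidean norm on $\mathbb R^d$ and let $A_d\colon\mathbb R^d\to\mathbb R^d$, $A_d(x_1,\dots,x_d)=(\max\{x_1,0\},\dots,\max\{x_d,0\})$. Let $$\mathbf N=\bigcup_{L\in\mathbb N}\ \bigcup_{(l_0,l_1,\dots,l_L)\in\mathbb N^{L+1}}\ \prod_{k=1}^{L}\big(\mathbb R^{l_k\times l_{k-1}}\times\mathbb R^{l_k}\big)$$ be the set of neural networks. For $\Phi=((W_1,B_1),\dots,(W_L,B_L))\in\prod_{k=1}^{L}(\mathbb R^{l_k\times l_{k-1}}\times\mathbb R^{l_k})$ let $P(\Phi)=\sum_{k=1}^{L}l_k(l_{k-1}+1)$ be its number of parameters, and let $R(\Phi)\in C(\mathbb R^{l_0},\mathbb R^{l_L})$ be its ReLU realization, that is, $(R(\Phi))(x_0)=W_Lx_{L-1}+B_L$, where $x_k=A_{l_k}(W_kx_{k-1}+B_k)$ for $1\le k<L$. **Theorem 1.1.** Let $\mathfrak C,T,\mathfrak d\in(0,\infty)$. Let $\Phi_d\in\mathbf N$, $d\in\mathbb N$,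 satisfy for all $d\in\mathbb N$, $x\in\mathbb R^d$ that $R(\Phi_d)\in C(\mathbb R^d,\mathbb R^d)$, $\|(R(\Phi_d))(x)\|\le\mathfrak C(1+\|x\|)$, and $P(\Phi_d)\le\mathfrak C d^{\mathfrak d}$. For $d,N\in\mathbb N$ let $Y^{d,N}=(Y^{d,N}_{t,x})_{(t,x)\in[0,T]\times\mathbb R^d}\colon[0,T]\times\mathbb R^d\to\mathbb R^d$ be the function which satisfies for all $n\in\{0,1,\dots,N-1\}$, $t\in[\frac{nT}{N},\frac{(n+1)T}{N}]$, $x\in\mathbb R^d$ that $Y^{d,N}_{0,x}=x$ and $$Y^{d,N}_{t,x}=Y^{d,N}_{\frac{nT}{N},x}+\big(t-\tfrac{nT}{N}\big)\,(R(\Phi_d))\big(Y^{d,N}_{\frac{nT}{N},x}\big).$$ Then there exist $C\in\mathbb R$ and $\Psi_{\varepsilon,d,N}\in\mathbf N$, $\varepsilon\in(0,1]$, $d,N\in\mathbb N$, such that for all $\varepsilon\in(0,1]$, $d,N\in\mathbb N$: 1. $R(\Psi_{\varepsilon,d,N})\in C(\mathbb R^{d+1},\mathbb R^d)$; 2. for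 all $t\in[0,T]$, $x\in\mathbb R^d$ it holds that $\|Y^{d,N}_{t,x}-(R(\Psi_{\varepsilon,d,N}))(t,x)\|\le C\,d^{1/2}N^{3/2}\,\varepsilon\,(1+\|x\|^3)$; 3. for all $t\in[0,T]$, $x\in\mathbb R^d$ it holds that $\|(R(\Psi_{\varepsilon,d,N}))(t,x)\|\le C\,d^{1/2}N\,(1+\|x\|^2)$; 4. $P(\Psi_{\varepsilon,d,N})\le C\,d^{16+8\mathfrak d}N^6\,\big(1+|\ln\varepsilon|^2\big)$. -/

import Mathlib

/-- `ReLUNet k l` is the set of all rectified neural networks with input dimension `k` and output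
dimension `l`, i.e. of all nonempty tuples `((W₁, B₁), …, (W_L, B_L))`, `L ≥ 1`, with
`W_j ∈ ℝ^{l_j × l_{j-1}}`, `B_j ∈ ℝ^{l_j}`, `l_0 = k`, `l_L = l`, where the dimensions of all hidden
layers are positive. `output W B` is the one-layer tuple `((W, B))`, and `hidden hm W B Φ` puts the
layer `(W, B)` in front of the tuple `Φ`. -/
inductive ReLUNet : ℕ → ℕ → Type
  | output {k l : ℕ} (W : Matrix (Fin l) (Fin k) ℝ) (B : Fin l → ℝ) : ReLUNet k l
  | hidden {k m l : ℕ} (hm : 0 < m) (W : Matrix (Fin m) (Fin k) ℝ) (B : Fin m → ℝ)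
      (Φ : ReLUNet m l) : ReLUNet k l

namespace ReLUNet

/-- The affine map `x ↦ W x + B` between Euclidean spaces. -/
def affineMap {k l : ℕ} (W : Matrix (Fin l) (Fin k) ℝ) (B : Fin l → ℝ)
    (x : EuclideanSpace ℝ (Fin k)) : EuclideanSpace ℝ (Fin l) :=
  WithLp.toLp 2 (fun i => W.mulVec x.ofLp i + B i)

/-- The componentwise rectifier `(x₁, …, x_d) ↦ (max {x₁, 0}, …, max {x_d, 0})`. -/
noncomputable def rectifier {d : ℕ} (x : EuclideanSpace ℝ (Fin d)) : EuclideanSpace ℝ (Fin d) :=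
  WithLp.toLp 2 (fun i => max (x i) 0)

/-- The realization `R(Φ) : ℝ^k → ℝ^l`: the rectifier is applied after every layer but the last. -/
noncomputable def realization : {k l : ℕ} → ReLUNet k l →
    EuclideanSpace ℝ (Fin k) → EuclideanSpace ℝ (Fin l)
  | _, _, output W B => fun x => affineMap W B x
  | _, _, hidden _ W B Φ => fun x => realization Φ (rectifier (affineMap W B x))

/-- The number of parameters `P(Φ) = ∑_{j=1}^L l_j (l_{j-1} + 1)`. -/
def params : {k l : ℕ} → ReLUNet k l → ℕ
  | k, l, output _ _ => l * (k + 1)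
  | k, _, hidden (m := m) _ _ _ Φ => m * (k + 1) + params Φ

end ReLUNet

/-- The point `(t, x) = (t, x₁, …, x_d) ∈ ℝ^{d+1}`. -/
def timeSpacePoint {d : ℕ} (t : ℝ) (x : EuclideanSpace ℝ (Fin d)) :
    EuclideanSpace ℝ (Fin (d + 1)) :=
  WithLp.toLp 2 (Fin.cons t x.ofLp)

/-! With step size h = T/N and f = R(Φ_d), the interpolated Euler scheme is x + ∑ₖ h · clamp(t/h −
k) · f(yₖ), where clamp truncates to [0, 1] and yₖ are the grid values. These grid values do not
depend on t, and networks compute them exactly by composition. Only the product of a clamped time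
and a vector must be approximated, and these errors add up without being fed back into the scheme,
so no Lipschitz bound on f is needed.

The product comes from polarization, with squares approximated by sums of iterated tent maps
(`abs_sawtoothSum_sub_le`); the second factor is truncated at height 2^m. This costs O(m) layers of
bounded width, gives error 2^(-m)(1 + |v|³), and keeps the output below 1 + |v|
(`abs_clampMul_sub_le`, `abs_clampMul_le`). Linear growth of f bounds f(yₖ) by a discrete Gronwall
argument. Choosing 2^(-m) ≤ ε yields both norm bounds. The network carries the state (t, yₙ, partial
sum) through N identical blocks, so depth times squared width bounds the number of parameters. -/

/-! ### Calculus of networks: composition, parallelization, identity. -/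

/-- `HasNet w L f` says that `f` is a composition of affine maps with `L` rectified hidden layers of
positive width at most `w` between them. -/
def HasNet (w : ℕ) {V' : Type} [AddCommGroup V'] [Module ℝ V'] :
    ℕ → ∀ {V : Type} [AddCommGroup V] [Module ℝ V], (V → V') → Prop
  | 0, V, _, _, f => ∃ A : V →ᵃ[ℝ] V', ∀ x, f x = A x
  | L + 1, V, _, _, f => ∃ m : ℕ, 0 < m ∧ m ≤ w ∧ ∃ (A : V →ᵃ[ℝ] (Fin m → ℝ))
      (g : (Fin m → ℝ) → V'), HasNet w L g ∧ ∀ x, f x = g (fun i => max (A x i) 0)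

namespace HasNet

variable {V V' U U' : Type} [AddCommGroup V] [Module ℝ V] [AddCommGroup V'] [Module ℝ V']
  [AddCommGroup U] [Module ℝ U] [AddCommGroup U'] [Module ℝ U']

theorem affine {w : ℕ} (A : V →ᵃ[ℝ] V') : HasNet w 0 A := ⟨A, fun _ => rfl⟩

theorem congr {w L : ℕ} {f g : V → V'} (hf : HasNet w L f) (h : ∀ x, g x = f x) :
    HasNet w L g := by
  rwa [show g = f from funext h]

theorem mono {w w' : ℕ} (hw : w ≤ w') {L : ℕ} {f : V → V'} (hf : HasNet w L f) :
    HasNet w' L f := by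
  induction L generalizing V with
  | zero => exact hf
  | succ L ih =>
    obtain ⟨m, hm, hmw, A, g, hg, h⟩ := hf
    exact ⟨m, hm, hmw.trans hw, A, g, ih hg, h⟩

theorem precomp {w L : ℕ} {f : V → V'} (hf : HasNet w L f) (B : U →ᵃ[ℝ] V) :
    HasNet w L (fun x => f (B x)) := by
  cases L with
  | zero =>
    obtain ⟨A, h⟩ := hf
    exact ⟨A.comp B, fun x => h (B x)⟩
  | succ L =>
    obtain ⟨m, hm, hmw, A, g, hg, h⟩ := hf
    exact ⟨m, hm, hmw, A.comp B, g, hg, fun x => h (B x)⟩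

/-- The last affine map of `f` merges with the first one of `g`, so depths add and the width does
not grow. -/
theorem comp {w L₁ L₂ : ℕ} {f : V → V'} {g : V' → U} (hg : HasNet w L₂ g) (hf : HasNet w L₁ f) :
    HasNet w (L₁ + L₂) (fun x => g (f x)) := by
  induction L₁ generalizing V with
  | zero =>
    obtain ⟨A, h⟩ := hf
    rw [Nat.zero_add]
    exact (hg.precomp A).congr fun x => by rw [h]
  | succ L ih =>
    obtain ⟨m, hm, hmw, A, f', hf', h⟩ := hf
    rw [Nat.add_right_comm]
    exact ⟨m, hm, hmw, A, _, ih hf', fun x => congrArg g (h x)⟩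

theorem postcomp {w L : ℕ} {f : V → V'} (hf : HasNet w L f) (B : V' →ᵃ[ℝ] U) :
    HasNet w L (fun x => B (f x)) :=
  (affine B).comp hf

/-- Hidden layers indexed by an arbitrary finite type. -/
theorem layer {ι : Type} [Fintype ι] [Nonempty ι] {w L : ℕ} (hw : Fintype.card ι ≤ w)
    (A : V →ᵃ[ℝ] (ι → ℝ)) {g : (ι → ℝ) → V'} (hg : HasNet w L g) :
    HasNet w (L + 1) (fun x => g (fun i => max (A x i) 0)) := by
  let e := Fintype.equivFin ι
  refine ⟨Fintype.card ι, Fintype.card_pos, hw,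
    (LinearMap.funLeft ℝ ℝ e.symm).toAffineMap.comp A, _,
    hg.precomp (LinearMap.funLeft ℝ ℝ e).toAffineMap, fun x => ?_⟩
  refine congrArg g (funext fun i => ?_)
  simp [LinearMap.funLeft_apply]

theorem prodMap {w₁ w₂ L : ℕ} {f : V → V'} {g : U → U'} (hf : HasNet w₁ L f)
    (hg : HasNet w₂ L g) : HasNet (w₁ + w₂) L (Prod.map f g) := by
  induction L generalizing V U with
  | zero =>
    obtain ⟨A, h⟩ := hf
    obtain ⟨B, h'⟩ := hg
    exact ⟨A.prodMap B, fun x => by simp [Prod.map, h, h']⟩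
  | succ L ih =>
    obtain ⟨m, hm, hmw, A, f', hf', h⟩ := hf
    obtain ⟨n, hn, hnw, B, g', hg', h'⟩ := hg
    have : Nonempty (Fin m ⊕ Fin n) := ⟨Sum.inl ⟨0, hm⟩⟩
    let e := LinearEquiv.sumArrowLequivProdArrow (Fin m) (Fin n) ℝ ℝ
    have := layer (w := w₁ + w₂) (by simpa using Nat.add_le_add hmw hnw)
      (e.symm.toLinearMap.toAffineMap.comp (A.prodMap B))
      ((ih hf' hg').precomp e.toLinearMap.toAffineMap)
    refine this.congr fun x => ?_
    simp only [Prod.map, h, h']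
    rfl

theorem piMap {ι : Type} [Fintype ι] [Nonempty ι] {w L : ℕ} {f : V → V'} (hf : HasNet w L f) :
    HasNet (Fintype.card ι * w) L (fun (x : ι → V) i => f (x i)) := by
  induction L generalizing V with
  | zero =>
    obtain ⟨A, h⟩ := hf
    exact ⟨AffineMap.pi fun i => A.comp (LinearMap.proj i : (ι → V) →ₗ[ℝ] V).toAffineMap,
      fun x => by funext i; simp [h]⟩
  | succ L ih =>
    obtain ⟨m, hm, hmw, A, f', hf', h⟩ := hf
    have : Nonempty (Fin m) := ⟨⟨0, hm⟩⟩
    let e := LinearEquiv.curry ℝ ℝ ι (Fin m)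
    have := layer (w := Fintype.card ι * w) (ι := ι × Fin m)
      (by simpa using Nat.mul_le_mul_left _ hmw)
      (e.symm.toLinearMap.toAffineMap.comp (AffineMap.pi fun i =>
        A.comp (LinearMap.proj i : (ι → V) →ₗ[ℝ] V).toAffineMap))
      ((ih hf').precomp e.toLinearMap.toAffineMap)
    refine this.congr fun x => ?_
    funext i
    simp only [h]
    rfl

/-- Since x = max(x, 0) − max(−x, 0), two units per coordinate carry a value through any number of
layers. This pads parallel networks to equal depth. -/
theorem id_pi {ι : Type} [Fintype ι] [Nonempty ι] (L : ℕ) :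
    HasNet (2 * Fintype.card ι) L (fun x : ι → ℝ => x) := by
  induction L with
  | zero => exact affine (AffineMap.id ℝ _)
  | succ L ih =>
    let e := LinearEquiv.sumArrowLequivProdArrow ι ι ℝ ℝ
    have := layer (w := 2 * Fintype.card ι) (ι := ι ⊕ ι) (by simp [two_mul])
      (e.symm.toLinearMap.comp (LinearMap.prod LinearMap.id (-LinearMap.id))).toAffineMap
      (ih.precomp ((LinearMap.fst ℝ (ι → ℝ) (ι → ℝ) - LinearMap.snd ℝ (ι → ℝ) (ι → ℝ)).comp
        e.toLinearMap).toAffineMap)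
    refine this.congr fun x => ?_
    funext i
    simp only [e, LinearMap.coe_toAffineMap, LinearMap.comp_apply, LinearEquiv.coe_coe]
    simp only [LinearMap.sub_apply, LinearMap.fst_apply, LinearMap.snd_apply, Pi.sub_apply]
    simp [LinearMap.prod_apply]

theorem id_of_finrank [FiniteDimensional ℝ V] (h : 0 < Module.finrank ℝ V) (L : ℕ) :
    HasNet (2 * Module.finrank ℝ V) L (fun x : V => x) := by
  have : Nonempty (Fin (Module.finrank ℝ V)) := ⟨⟨0, h⟩⟩
  let e := (Module.finBasis ℝ V).equivFun
  have := ((id_pi (ι := Fin (Module.finrank ℝ V)) L).precomp e.toLinearMap.toAffineMap).postcomp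
    e.symm.toLinearMap.toAffineMap
  rw [Fintype.card_fin] at this
  refine this.congr fun x => ?_
  simp

end HasNet

/-! ### Translation between parameter counts and width/depth. -/

namespace ReLUNet

theorem continuous_realization {k l : ℕ} (Φ : ReLUNet k l) : Continuous Φ.realization := by
  have aff : ∀ {k l : ℕ} (W : Matrix (Fin l) (Fin k) ℝ) (B : Fin l → ℝ),
      Continuous (affineMap W B) := fun W B => by
    unfold affineMap Matrix.mulVec dotProduct
    fun_prop
  induction Φ with
  | output W B => exact aff W B
  | @hidden _ m _ hm W B Φ ih =>
    have hr : Continuous (rectifier (d := m)) := by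
      unfold rectifier
      fun_prop
    exact ih.comp (hr.comp (aff W B))

/-- Every hidden unit owns at least one parameter, so the parameter count bounds both the depth and
all hidden widths. -/
theorem exists_hasNet {k l w : ℕ} (Φ : ReLUNet k l) (hw : Φ.params ≤ w) :
    ∃ L ≤ Φ.params, HasNet w L Φ.realization := by
  let aff : ∀ {k l : ℕ}, Matrix (Fin l) (Fin k) ℝ → (Fin l → ℝ) →
      (EuclideanSpace ℝ (Fin k) →ᵃ[ℝ] (Fin l → ℝ)) := fun {k l} W B =>
    (W.mulVecLin.comp (WithLp.linearEquiv 2 ℝ (Fin k → ℝ)).toLinearMap).toAffineMap +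
      AffineMap.const ℝ _ B
  induction Φ with
  | @output k l W B =>
    exact ⟨0, Nat.zero_le _,
      (WithLp.linearEquiv 2 ℝ (Fin l → ℝ)).symm.toLinearMap.toAffineMap.comp (aff W B),
      fun x => rfl⟩
  | @hidden k m l hm W B Φ ih =>
    have hp : (hidden hm W B Φ).params = m * (k + 1) + Φ.params := rfl
    rw [hp] at hw ⊢
    obtain ⟨L, hL, h⟩ := ih (by omega)
    have h1 : m ≤ m * (k + 1) := Nat.le_mul_of_pos_right _ (Nat.succ_pos _)
    exact ⟨L + 1, by omega, m, hm, by omega, aff W B, _,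
      h.precomp (WithLp.linearEquiv 2 ℝ (Fin m → ℝ)).symm.toLinearMap.toAffineMap, fun x => rfl⟩

theorem exists_affineMap_eq {k l : ℕ}
    (A : EuclideanSpace ℝ (Fin k) →ᵃ[ℝ] EuclideanSpace ℝ (Fin l)) :
    ∃ (W : Matrix (Fin l) (Fin k) ℝ) (B : Fin l → ℝ), ∀ x, affineMap W B x = A x := by
  refine ⟨LinearMap.toMatrix' ((WithLp.linearEquiv 2 ℝ (Fin l → ℝ)).toLinearMap.comp
    (A.linear.comp (WithLp.linearEquiv 2 ℝ (Fin k → ℝ)).symm.toLinearMap)), (A 0).ofLp,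
    fun x => ?_⟩
  have := congrFun A.decomp x
  ext i
  rw [this]
  simp [affineMap, LinearMap.toMatrix'_mulVec]

theorem exists_of_hasNet {k l w L : ℕ} (hk : k ≤ w) (hl : l ≤ w)
    {f : EuclideanSpace ℝ (Fin k) → EuclideanSpace ℝ (Fin l)} (hf : HasNet w L f) :
    ∃ Φ : ReLUNet k l, Φ.params ≤ (L + 1) * (w * (w + 1)) ∧ ∀ x, Φ.realization x = f x := by
  induction L generalizing k with
  | zero =>
    obtain ⟨A, h⟩ := hf
    obtain ⟨W, B, hA⟩ := exists_affineMap_eq A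
    refine ⟨output W B, ?_, fun x => by rw [h, ← hA]; rfl⟩
    have : (output W B).params = l * (k + 1) := rfl
    rw [this, zero_add, one_mul]
    gcongr
  | succ L ih =>
    obtain ⟨m, hm, hmw, A, g, hg, h⟩ := hf
    let e := WithLp.linearEquiv 2 ℝ (Fin m → ℝ)
    obtain ⟨W, B, hA⟩ := exists_affineMap_eq (e.symm.toLinearMap.toAffineMap.comp A)
    obtain ⟨Φ, hp, hr⟩ := ih hmw (hg.precomp e.toLinearMap.toAffineMap)
    refine ⟨hidden hm W B Φ, ?_, fun x => ?_⟩
    · have : (hidden hm W B Φ).params = m * (k + 1) + Φ.params := rfl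
      rw [this, Nat.succ_mul, add_comm]
      gcongr
    · change Φ.realization (rectifier (affineMap W B x)) = f x
      rw [hr, h, hA]
      rfl

end ReLUNet

/-! ### Approximate multiplication. -/

/-- The tent map on the unit interval, as a combination of two rectifiers. -/
noncomputable def tent (x : ℝ) : ℝ := 2 * max x 0 - 4 * max (x - 1 / 2) 0

/-- `sawtoothSum m a (x, c)` approximates `c + a * (x - x ^ 2)` for `x` in the unit interval, by a sum
of `m` sawtooth functions. -/
noncomputable def sawtoothSum : ℕ → ℝ → ℝ × ℝ → ℝ
  | 0, _, p => p.2
  | m + 1, a, p => sawtoothSum m (a / 4) (tent p.1, p.2 + a / 4 * tent p.1)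

/-- The clamping of `s` to the unit interval. -/
noncomputable def unitClamp (s : ℝ) : ℝ := max s 0 - max (s - 1) 0

/-- The clamping of `v` to the interval from `-1` to `1`. -/
noncomputable def symmClamp (v : ℝ) : ℝ := max (v + 1) 0 - max (v - 1) 0 - 1

/-- The absolute value, as a combination of two rectifiers. -/
noncomputable def reluAbs (x : ℝ) : ℝ := max x 0 + max (-x) 0

/-- `clampMul m (s, v)` approximates `unitClamp s * v`. -/
noncomputable def clampMul (m : ℕ) (p : ℝ × ℝ) : ℝ :=
  2 ^ m *
    (sawtoothSum m (-1) (reluAbs (unitClamp p.1 + symmClamp (p.2 / 2 ^ m)) / 2,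
        reluAbs (unitClamp p.1 + symmClamp (p.2 / 2 ^ m)) / 2) -
      sawtoothSum m (-1) (reluAbs (unitClamp p.1 - symmClamp (p.2 / 2 ^ m)) / 2,
        reluAbs (unitClamp p.1 - symmClamp (p.2 / 2 ^ m)) / 2))

theorem tent_mem {x : ℝ} (h0 : 0 ≤ x) (h1 : x ≤ 1) : 0 ≤ tent x ∧ tent x ≤ 1 := by
  unfold tent
  rw [max_eq_left h0]
  rcases max_cases (x - 1 / 2) 0 with h | h <;> constructor <;> linarith

/-- Self-similarity of the parabola: x − x² is symmetric about 1/2, hence a function of the tent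
map. Iterating this identity shrinks the quadratic remainder by a factor 4 each time. -/
theorem tent_mul {x : ℝ} (h0 : 0 ≤ x) :
    x - x ^ 2 = tent x / 4 + (tent x - tent x ^ 2) / 4 := by
  unfold tent
  rw [max_eq_left h0]
  rcases max_cases (x - 1 / 2) 0 with h | h <;> rw [h.1] <;> ring

theorem abs_sawtoothSum_sub_le (m : ℕ) (a c : ℝ) {x : ℝ} (h0 : 0 ≤ x) (h1 : x ≤ 1) :
    |sawtoothSum m a (x, c) - (c + a * (x - x ^ 2))| ≤ |a| / 4 ^ (m + 1) := by
  induction m generalizing a c x with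
  | zero =>
    have h : |x - x ^ 2| ≤ 1 / 4 := by
      rw [abs_le]
      constructor <;> nlinarith [sq_nonneg (x - 1 / 2)]
    have : sawtoothSum 0 a (x, c) - (c + a * (x - x ^ 2)) = -(a * (x - x ^ 2)) := by
      simp [sawtoothSum]
    rw [this, abs_neg, abs_mul]
    calc |a| * |x - x ^ 2| ≤ |a| * (1 / 4) := by gcongr
      _ = _ := by ring
  | succ m ih =>
    obtain ⟨t0, t1⟩ := tent_mem h0 h1
    have := ih (a / 4) (c + a / 4 * tent x) t0 t1
    rw [tent_mul h0]
    have e : c + a * (tent x / 4 + (tent x - tent x ^ 2) / 4) =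
        c + a / 4 * tent x + a / 4 * (tent x - tent x ^ 2) := by ring
    rw [e]
    refine this.trans (le_of_eq ?_)
    rw [abs_div, abs_of_pos (by norm_num : (0 : ℝ) < 4), pow_succ (4 : ℝ) (m + 1)]
    field_simp

theorem unitClamp_of_nonpos {s : ℝ} (h : s ≤ 0) : unitClamp s = 0 := by
  rw [unitClamp, max_eq_right h, max_eq_right (by linarith), sub_zero]

theorem unitClamp_of_one_le {s : ℝ} (h : 1 ≤ s) : unitClamp s = 1 := by
  rw [unitClamp, max_eq_left (by linarith), max_eq_left (by linarith)]
  ring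

theorem unitClamp_of_mem {s : ℝ} (h0 : 0 ≤ s) (h1 : s ≤ 1) : unitClamp s = s := by
  rw [unitClamp, max_eq_left h0, max_eq_right (by linarith), sub_zero]

theorem unitClamp_mem (s : ℝ) : 0 ≤ unitClamp s ∧ unitClamp s ≤ 1 := by
  unfold unitClamp
  rcases max_cases s 0 with h | h <;> rcases max_cases (s - 1) 0 with h' | h' <;> constructor <;>
    linarith

theorem symmClamp_mem (v : ℝ) : -1 ≤ symmClamp v ∧ symmClamp v ≤ 1 := by
  unfold symmClamp
  rcases max_cases (v + 1) 0 with h | h <;> rcases max_cases (v - 1) 0 with h' | h' <;>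
    constructor <;> linarith

theorem abs_symmClamp_le (v : ℝ) : |symmClamp v| ≤ |v| := by
  unfold symmClamp
  rcases abs_cases v with ⟨h, h1⟩ | ⟨h, h1⟩ <;> rw [h, abs_le] <;>
  rcases max_cases (v + 1) 0 with h | h <;> rcases max_cases (v - 1) 0 with h' | h' <;>
    constructor <;> linarith

/-- There is no error for |v| ≤ 1, and otherwise |v| ≤ |v|³. After rescaling by 2^m the cube turns
into a gain of 4^(-m). -/
theorem abs_symmClamp_sub_le (v : ℝ) : |symmClamp v - v| ≤ |v| ^ 3 := by
  rcases le_or_gt |v| 1 with h | h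
  · have h' := abs_le.1 h
    have : symmClamp v - v = 0 := by
      unfold symmClamp
      rw [max_eq_left (by linarith), max_eq_right (by linarith)]
      ring
    rw [this, abs_zero]
    positivity
  · have h2 : |symmClamp v - v| ≤ |v| := by
      unfold symmClamp
      rcases abs_cases v with ⟨h, h1⟩ | ⟨h, h1⟩ <;> rw [h, abs_le] <;>
      rcases max_cases (v + 1) 0 with h | h <;> rcases max_cases (v - 1) 0 with h' | h' <;>
        constructor <;> linarith
    exact h2.trans (le_self_pow₀ h.le (by norm_num))

theorem reluAbs_eq (x : ℝ) : reluAbs x = |x| := by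
  unfold reluAbs
  rcases abs_cases x with ⟨h, h1⟩ | ⟨h, h1⟩ <;> rw [h]
  · rw [max_eq_left h1, max_eq_right (by linarith), add_zero]
  · rw [max_eq_right h1.le, max_eq_left (by linarith), zero_add]

/-- Polarization τu = ((τ+u)/2)² − ((τ−u)/2)². Rescaling amplifies the two sawtooth errors 4^(-m-1)
by 2^m, which still leaves 2^(-m)/2. -/
theorem abs_clampMul_sub_scaled_le (m : ℕ) (s v : ℝ) :
    |clampMul m (s, v) - unitClamp s * (2 ^ m * symmClamp (v / 2 ^ m))| ≤ (1 / 2) ^ m := by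
  obtain ⟨t0, t1⟩ := unitClamp_mem s
  obtain ⟨u0, u1⟩ := symmClamp_mem (v / 2 ^ m)
  have hR : (0 : ℝ) < 2 ^ m := by positivity
  unfold clampMul
  simp only [reluAbs_eq]
  generalize unitClamp s = τ at *
  generalize symmClamp (v / 2 ^ m) = u at *
  have ha : |τ + u| / 2 ≤ 1 := by
    have := abs_le.2 (⟨by linarith, by linarith⟩ : -2 ≤ τ + u ∧ τ + u ≤ 2)
    linarith
  have hb : |τ - u| / 2 ≤ 1 := by
    have := abs_le.2 (⟨by linarith, by linarith⟩ : -2 ≤ τ - u ∧ τ - u ≤ 2)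
    linarith
  have h1 := abs_sawtoothSum_sub_le m (-1) (|τ + u| / 2) (by positivity) ha
  have h2 := abs_sawtoothSum_sub_le m (-1) (|τ - u| / 2) (by positivity) hb
  have ea : |τ + u| / 2 + -1 * (|τ + u| / 2 - (|τ + u| / 2) ^ 2) = (τ + u) ^ 2 / 4 := by
    rw [← sq_abs (τ + u)]
    ring
  have eb : |τ - u| / 2 + -1 * (|τ - u| / 2 - (|τ - u| / 2) ^ 2) = (τ - u) ^ 2 / 4 := by
    rw [← sq_abs (τ - u)]
    ring
  rw [ea] at h1
  rw [eb] at h2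
  generalize sawtoothSum m (-1) (|τ + u| / 2, |τ + u| / 2) = A at *
  generalize sawtoothSum m (-1) (|τ - u| / 2, |τ - u| / 2) = B at *
  have e : 2 ^ m * (A - B) - τ * (2 ^ m * u) =
      2 ^ m * ((A - (τ + u) ^ 2 / 4) - (B - (τ - u) ^ 2 / 4)) := by ring
  rw [e, abs_mul, abs_of_pos hR]
  have h3 := (abs_sub (A - (τ + u) ^ 2 / 4) (B - (τ - u) ^ 2 / 4)).trans (add_le_add h1 h2)
  calc 2 ^ m * |(A - (τ + u) ^ 2 / 4) - (B - (τ - u) ^ 2 / 4)|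
      ≤ 2 ^ m * (|(-1 : ℝ)| / 4 ^ (m + 1) + |(-1 : ℝ)| / 4 ^ (m + 1)) := by gcongr
    _ = (1 / 2) ^ m / 2 := by
        rw [abs_neg, abs_one, pow_succ, show (4 : ℝ) = 2 * 2 by norm_num, mul_pow,
          one_div_pow]
        field_simp
        norm_num
    _ ≤ (1 / 2) ^ m := half_le_self (by positivity)

theorem abs_clampMul_sub_le (m : ℕ) (s v : ℝ) :
    |clampMul m (s, v) - unitClamp s * v| ≤ (1 / 2) ^ m * (1 + |v| ^ 3) := by
  obtain ⟨t0, t1⟩ := unitClamp_mem s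
  have hR : (1 : ℝ) ≤ 2 ^ m := one_le_pow₀ (by norm_num)
  have hR0 : (0 : ℝ) < 2 ^ m := by positivity
  have h1 := abs_clampMul_sub_scaled_le m s v
  have h2 := abs_symmClamp_sub_le (v / 2 ^ m)
  have e : unitClamp s * (2 ^ m * symmClamp (v / 2 ^ m)) - unitClamp s * v =
      unitClamp s * (2 ^ m * (symmClamp (v / 2 ^ m) - v / 2 ^ m)) := by
    field_simp
  have h3 : |unitClamp s * (2 ^ m * symmClamp (v / 2 ^ m)) - unitClamp s * v| ≤
      (1 / 2) ^ m * |v| ^ 3 := by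
    rw [e, abs_mul, abs_mul, abs_of_nonneg t0, abs_of_pos hR0]
    calc unitClamp s * (2 ^ m * |symmClamp (v / 2 ^ m) - v / 2 ^ m|)
        ≤ 1 * (2 ^ m * |v / 2 ^ m| ^ 3) := by gcongr
      _ = (1 / 2) ^ m * ((1 / 2) ^ m * |v| ^ 3) := by
          rw [abs_div, abs_of_pos hR0, one_div, inv_pow]
          field_simp
      _ ≤ (1 / 2) ^ m * (1 * |v| ^ 3) := by
          gcongr
          exact pow_le_one₀ (by norm_num) (by norm_num)
      _ = _ := by ring
  calc _ ≤ _ := abs_sub_le _ _ _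
    _ ≤ _ := add_le_add h1 h3
    _ = _ := by ring

theorem abs_clampMul_le (m : ℕ) (s v : ℝ) : |clampMul m (s, v)| ≤ 1 + |v| := by
  obtain ⟨t0, t1⟩ := unitClamp_mem s
  have hR0 : (0 : ℝ) < 2 ^ m := by positivity
  have h1 := (abs_clampMul_sub_scaled_le m s v).trans (pow_le_one₀ (by norm_num) (by norm_num))
  have h2 : |unitClamp s * (2 ^ m * symmClamp (v / 2 ^ m))| ≤ |v| := by
    rw [abs_mul, abs_mul, abs_of_nonneg t0, abs_of_pos hR0]
    calc _ ≤ 1 * (2 ^ m * |v / 2 ^ m|) := by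
          exact mul_le_mul t1 (mul_le_mul_of_nonneg_left (abs_symmClamp_le _) hR0.le)
            (by positivity) zero_le_one
      _ = |v| := by
          rw [abs_div, abs_of_pos hR0]
          field_simp
  calc |clampMul m (s, v)|
      = |(clampMul m (s, v) - unitClamp s * (2 ^ m * symmClamp (v / 2 ^ m))) +
          unitClamp s * (2 ^ m * symmClamp (v / 2 ^ m))| := by rw [sub_add_cancel]
    _ ≤ _ := abs_add_le _ _
    _ ≤ _ := add_le_add h1 h2

/-! ### Networks for the approximate product. -/

/-- The affine functional `(x, y) ↦ p * x + q * y + c`. -/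
noncomputable def pairFunctional (p q c : ℝ) : ℝ × ℝ →ᵃ[ℝ] ℝ :=
  (p • LinearMap.fst ℝ ℝ ℝ + q • LinearMap.snd ℝ ℝ ℝ).toAffineMap + AffineMap.const ℝ _ c

theorem pairFunctional_apply (p q c : ℝ) (x : ℝ × ℝ) :
    pairFunctional p q c x = p * x.1 + q * x.2 + c := rfl

/-- The affine functional `x ↦ ∑ i, w i * x i + c` in four variables. -/
noncomputable def fourFunctional (w : Fin 4 → ℝ) (c : ℝ) : (Fin 4 → ℝ) →ᵃ[ℝ] ℝ :=
  (∑ i, w i • (LinearMap.proj i : (Fin 4 → ℝ) →ₗ[ℝ] ℝ)).toAffineMap + AffineMap.const ℝ _ c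

theorem fourFunctional_apply (w : Fin 4 → ℝ) (c : ℝ) (x : Fin 4 → ℝ) :
    fourFunctional w c x = w 0 * x 0 + w 1 * x 1 + w 2 * x 2 + w 3 * x 3 + c := by
  simp [fourFunctional, Fin.sum_univ_four]

/-- A layer with four hidden units, from the plane to itself. -/
theorem HasNet.planeLayer (a : Fin 4 → ℝ × ℝ →ᵃ[ℝ] ℝ) (w₁ w₂ : Fin 4 → ℝ) (c₁ c₂ : ℝ) :
    HasNet 4 1 (fun x : ℝ × ℝ =>
      (w₁ 0 * max (a 0 x) 0 + w₁ 1 * max (a 1 x) 0 + w₁ 2 * max (a 2 x) 0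
        + w₁ 3 * max (a 3 x) 0 + c₁,
      w₂ 0 * max (a 0 x) 0 + w₂ 1 * max (a 1 x) 0 + w₂ 2 * max (a 2 x) 0
        + w₂ 3 * max (a 3 x) 0 + c₂)) := by
  have := HasNet.layer (w := 4) (ι := Fin 4) (by simp) (AffineMap.pi a)
    (HasNet.affine ((fourFunctional w₁ c₁).prod (fourFunctional w₂ c₂)))
  refine this.congr fun x => ?_
  simp [fourFunctional_apply]

theorem max_sub_max_neg (x : ℝ) : max x 0 - max (-x) 0 = x := by
  rcases le_total 0 x with h | h
  · rw [max_eq_left h, max_eq_right (by linarith), sub_zero]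
  · rw [max_eq_right h, max_eq_left (by linarith)]
    ring

theorem hasNet_sawtoothSum (m : ℕ) (a : ℝ) : HasNet 4 m (sawtoothSum m a) := by
  induction m generalizing a with
  | zero => exact ⟨(LinearMap.snd ℝ ℝ ℝ).toAffineMap, fun _ => rfl⟩
  | succ m ih =>
    -- Two units form the tent map; the other two carry the signed accumulator.
    have h := (ih (a / 4)).comp (HasNet.planeLayer ![pairFunctional 1 0 0,
      pairFunctional 1 0 (-1 / 2), pairFunctional 0 1 0, pairFunctional 0 (-1) 0]
      ![2, -4, 0, 0] ![a / 4 * 2, -(a / 4 * 4), 1, -1] 0 0)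
    rw [add_comm 1 m] at h
    refine h.congr fun x => ?_
    simp only [sawtoothSum, tent]
    congr 2
    · simp [pairFunctional_apply]
      ring_nf
    · have := max_sub_max_neg x.2
      simp [pairFunctional_apply]
      ring_nf at this ⊢
      linarith

theorem hasNet_clampMul (m : ℕ) : HasNet 8 (m + 2) (clampMul m) := by
  -- The first layer computes both clamps, the second both halved absolute values; the two sawtooth
  -- sums then run in parallel.
  have h1 := HasNet.planeLayer ![pairFunctional 1 0 0, pairFunctional 1 0 (-1),
      pairFunctional 0 (1 / 2 ^ m) 1, pairFunctional 0 (1 / 2 ^ m) (-1)]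
      ![1, -1, 0, 0] ![0, 0, 1, -1] 0 (-1)
  have h2 := HasNet.planeLayer ![pairFunctional 1 1 0, pairFunctional (-1) (-1) 0,
      pairFunctional 1 (-1) 0, pairFunctional (-1) 1 0]
      ![1 / 2, 1 / 2, 0, 0] ![0, 0, 1 / 2, 1 / 2] 0 0
  have h3 := ((hasNet_sawtoothSum m (-1)).prodMap (hasNet_sawtoothSum m (-1))).precomp
    (((LinearMap.fst ℝ ℝ ℝ).prod (LinearMap.fst ℝ ℝ ℝ)).prod
      ((LinearMap.snd ℝ ℝ ℝ).prod (LinearMap.snd ℝ ℝ ℝ))).toAffineMap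
  have h4 := (h3.comp ((h2.comp h1).mono (by norm_num))).postcomp
    (pairFunctional (2 ^ m) (-2 ^ m) 0)
  rw [show 1 + 1 + m = m + 2 by ring] at h4
  refine h4.congr fun x => ?_
  have e1 : max (x.2 / 2 ^ m - 1) 0 = max ((2 ^ m)⁻¹ * x.2 + -1) 0 := by
    congr 1
    ring
  have e2 : max (x.2 / 2 ^ m + 1) 0 = max ((2 ^ m)⁻¹ * x.2 + 1) 0 := by
    congr 1
    ring
  simp only [clampMul, reluAbs, unitClamp, symmClamp, e1, e2]
  simp [pairFunctional_apply]
  ring_nf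

/-! ### The Euler scheme as a sum of clamped ramps. -/

/-- The values at the grid points of the explicit Euler scheme for `f` with step size `h`. -/
def eulerGrid {E : Type*} [AddCommGroup E] [Module ℝ E] (f : E → E) (h : ℝ) (x : E) : ℕ → E
  | 0 => x
  | n + 1 => eulerGrid f h x n + h • f (eulerGrid f h x n)

/-- Discrete Gronwall: each step multiplies 1 + ‖y‖ by at most 1 + ch ≤ exp(ch). -/
theorem norm_eulerGrid_le {E : Type*} [NormedAddCommGroup E] [NormedSpace ℝ E] {f : E → E}
    {c h : ℝ} (hh : 0 ≤ h) (hf : ∀ x, ‖f x‖ ≤ c * (1 + ‖x‖)) (x : E) (n : ℕ) :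
    1 + ‖eulerGrid f h x n‖ ≤ Real.exp (n * (c * h)) * (1 + ‖x‖) := by
  induction n with
  | zero => simp [eulerGrid]
  | succ n ih =>
    calc 1 + ‖eulerGrid f h x n + h • f (eulerGrid f h x n)‖
        ≤ 1 + (‖eulerGrid f h x n‖ + h * (c * (1 + ‖eulerGrid f h x n‖))) := by
          have := norm_add_le (eulerGrid f h x n) (h • f (eulerGrid f h x n))
          rw [norm_smul, Real.norm_of_nonneg hh] at this
          have := mul_le_mul_of_nonneg_left (hf (eulerGrid f h x n)) hh
          linarith
      _ = (c * h + 1) * (1 + ‖eulerGrid f h x n‖) := by ring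
      _ ≤ Real.exp (c * h) * (Real.exp (n * (c * h)) * (1 + ‖x‖)) := by
          gcongr
          exact Real.add_one_le_exp _
      _ = Real.exp (((n + 1 : ℕ) : ℝ) * (c * h)) * (1 + ‖x‖) := by
          rw [← mul_assoc, ← Real.exp_add]
          push_cast
          ring_nf

theorem add_sum_unitClamp_smul_of_le {E : Type*} [AddCommGroup E] [Module ℝ E] (f : E → E)
    {h : ℝ} (hh : 0 < h) (x : E) {n : ℕ} {t : ℝ} (ht : n * h ≤ t) :
    x + ∑ k ∈ Finset.range n, (h * unitClamp (t / h - k)) • f (eulerGrid f h x k) =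
      eulerGrid f h x n := by
  induction n with
  | zero => simp [eulerGrid]
  | succ n ih =>
    push_cast at ht
    have h1 : 1 ≤ t / h - n := by
      rw [le_sub_iff_add_le, le_div_iff₀ hh]
      linarith
    rw [Finset.sum_range_succ, ← add_assoc, ih (by nlinarith), unitClamp_of_one_le h1, mul_one]
    rfl

/-- The k-th ramp vanishes before time kh and equals 1 after (k+1)h: past steps contribute fully,
future ones not at all, and the current one linearly. -/
theorem euler_interpolation_eq {E : Type*} [AddCommGroup E] [Module ℝ E] {f : E → E} {h : ℝ}
    (hh : 0 < h) {N : ℕ} {x : E} {Y : ℝ → E} (h0 : Y 0 = x)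
    (hY : ∀ n < N, ∀ t ∈ Set.Icc ((n : ℝ) * h) ((n + 1 : ℝ) * h),
      Y t = Y (n * h) + (t - n * h) • f (Y (n * h)))
    {n : ℕ} (hn : n ≤ N) {t : ℝ} (ht0 : 0 ≤ t) (ht : t ≤ n * h) :
    Y t = x + ∑ k ∈ Finset.range n, (h * unitClamp (t / h - k)) • f (eulerGrid f h x k) := by
  induction n generalizing t with
  | zero =>
    have : t = 0 := le_antisymm (by simpa using ht) ht0
    simp [this, h0]
  | succ n ih =>
    push_cast at ht
    rw [Finset.sum_range_succ, ← add_assoc]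
    rcases le_total t (n * h) with htn | htn
    · have h1 : t / h - n ≤ 0 := by
        rw [sub_nonpos, div_le_iff₀ hh]
        exact htn
      rw [ih (by omega) ht0 htn, unitClamp_of_nonpos h1, mul_zero, zero_smul, add_zero]
    · have hgrid : Y (n * h) = eulerGrid f h x n := by
        rw [ih (by omega) (by positivity) le_rfl, add_sum_unitClamp_smul_of_le f hh x le_rfl]
      have h1 : 0 ≤ t / h - n := by
        rw [sub_nonneg, le_div_iff₀ hh]
        exact htn
      have h2 : t / h - n ≤ 1 := by
        rw [sub_le_iff_le_add, div_le_iff₀ hh]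
        linarith
      rw [hY n (by omega) t ⟨htn, ht⟩, hgrid, add_sum_unitClamp_smul_of_le f hh x htn,
        unitClamp_of_mem h1 h2]
      congr 2
      field_simp

/-! ### From coordinatewise to Euclidean bounds. -/

theorem norm_le_of_abs_apply_le {d : ℕ} {w v : EuclideanSpace ℝ (Fin d)} {c a : ℝ} (hc : 0 ≤ c)
    (ha : 0 ≤ a) (h : ∀ i, |w i| ≤ c * (1 + a * |v i|)) :
    ‖w‖ ≤ c * (Real.sqrt d + a * ‖v‖) := by
  let o : EuclideanSpace ℝ (Fin d) := WithLp.toLp 2 fun _ => 1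
  let z : EuclideanSpace ℝ (Fin d) := WithLp.toLp 2 fun i => |v i|
  have ho : ‖o‖ = Real.sqrt d := by simp [o, EuclideanSpace.norm_eq]
  have hz : ‖z‖ = ‖v‖ := by simp [z, EuclideanSpace.norm_eq]
  have hw : ‖w‖ ≤ ‖c • (o + a • z)‖ := by
    rw [EuclideanSpace.norm_eq, EuclideanSpace.norm_eq]
    refine Real.sqrt_le_sqrt (Finset.sum_le_sum fun i _ => ?_)
    have : (c • (o + a • z)) i = c * (1 + a * |v i|) := by
      simp [o, z]
      ring
    rw [this, Real.norm_eq_abs, Real.norm_eq_abs]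
    exact pow_le_pow_left₀ (abs_nonneg _) ((h i).trans (le_abs_self _)) 2
  refine hw.trans ?_
  rw [norm_smul, Real.norm_of_nonneg hc]
  gcongr
  refine (norm_add_le _ _).trans ?_
  rw [norm_smul, Real.norm_of_nonneg ha, ho, hz]

/-- The approximation of `(h * unitClamp s) • v`. -/
noncomputable def clampSMul (m : ℕ) (h s : ℝ) {d : ℕ} (v : EuclideanSpace ℝ (Fin d)) :
    EuclideanSpace ℝ (Fin d) :=
  h • WithLp.toLp 2 fun i => clampMul m (s, v i)

theorem norm_clampSMul_le {d : ℕ} (m : ℕ) {h : ℝ} (hh : 0 ≤ h) (s : ℝ)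
    (v : EuclideanSpace ℝ (Fin d)) : ‖clampSMul m h s v‖ ≤ h * (Real.sqrt d + ‖v‖) := by
  have := norm_le_of_abs_apply_le (w := clampSMul m h s v) (v := v) hh zero_le_one fun i => by
    have : clampSMul m h s v i = h * clampMul m (s, v i) := rfl
    rw [this, abs_mul, abs_of_nonneg hh, one_mul]
    gcongr
    exact abs_clampMul_le m s (v i)
  rwa [one_mul] at this

theorem norm_smul_sub_clampSMul_le {d : ℕ} (m : ℕ) {h : ℝ} (hh : 0 ≤ h) (s : ℝ)
    (v : EuclideanSpace ℝ (Fin d)) :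
    ‖(h * unitClamp s) • v - clampSMul m h s v‖ ≤ h * (1 / 2) ^ m * (Real.sqrt d + ‖v‖ ^ 3) := by
  -- The cubic coordinate error is made linear by |vᵢ|³ ≤ ‖v‖²|vᵢ|, hence `a = ‖v‖ ^ 2`.
  have := norm_le_of_abs_apply_le (w := (h * unitClamp s) • v - clampSMul m h s v) (v := v)
    (c := h * (1 / 2) ^ m) (a := ‖v‖ ^ 2) (by positivity) (by positivity) fun i => by
      have e : ((h * unitClamp s) • v - clampSMul m h s v) i =
          -(h * (clampMul m (s, v i) - unitClamp s * v i)) := by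
        simp [clampSMul]
        ring
      have hv : |v i| ≤ ‖v‖ := PiLp.norm_apply_le v i
      rw [e, abs_neg, abs_mul, abs_of_nonneg hh, mul_assoc]
      gcongr
      refine (abs_clampMul_sub_le m s (v i)).trans ?_
      gcongr
      rw [pow_succ]
      gcongr
  rwa [← pow_succ] at this

/-! ### The approximating network: size, growth and error. -/

/-- The approximation of the Euler interpolation on `n` steps that rectified networks compute. -/
noncomputable def eulerApprox {d : ℕ} (f : EuclideanSpace ℝ (Fin d) → EuclideanSpace ℝ (Fin d))
    (h : ℝ) (m n : ℕ) (t : ℝ) (x : EuclideanSpace ℝ (Fin d)) : EuclideanSpace ℝ (Fin d) :=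
  x + ∑ k ∈ Finset.range n, clampSMul m h (t / h - k) (f (eulerGrid f h x k))

/-- Carrying the (1 + 2d)-dimensional state takes 2(1 + 2d) ≤ 6d units. It runs beside `f` (width
w), then beside d product networks (width 8d), so w + 14d suffices for both stages. -/
theorem hasNet_eulerStep {d w L : ℕ} (hd : 0 < d)
    {f : EuclideanSpace ℝ (Fin d) → EuclideanSpace ℝ (Fin d)} (hf : HasNet w L f) (h : ℝ)
    (m n : ℕ) :
    HasNet (w + 14 * d) (L + (m + 2))
      (fun p : ℝ × EuclideanSpace ℝ (Fin d) × EuclideanSpace ℝ (Fin d) =>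
        (p.1, p.2.1 + h • f p.2.1, p.2.2 + clampSMul m h (p.1 / h - n) (f p.2.1))) := by
  have : Nonempty (Fin d) := ⟨⟨0, hd⟩⟩
  let E := EuclideanSpace ℝ (Fin d)
  let S := ℝ × E × E
  have hr : Module.finrank ℝ S = 1 + 2 * d := by simp [S, E, two_mul]
  have hid : ∀ k, HasNet (2 * (1 + 2 * d)) k (fun p : S => p) := fun k => by
    have := HasNet.id_of_finrank (V := S) (by omega) k
    rwa [hr] at this
  let fstS : S →ₗ[ℝ] ℝ := LinearMap.fst ℝ ℝ (E × E)
  let midS : S →ₗ[ℝ] E := (LinearMap.fst ℝ E E).comp (LinearMap.snd ℝ ℝ (E × E))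
  let lastS : S →ₗ[ℝ] E := (LinearMap.snd ℝ E E).comp (LinearMap.snd ℝ ℝ (E × E))
  have h1 := (hf.prodMap (hid L)).precomp (midS.prod LinearMap.id).toAffineMap
  let coord : Fin d → E →ₗ[ℝ] ℝ := fun i =>
    (LinearMap.proj i).comp (WithLp.linearEquiv 2 ℝ (Fin d → ℝ)).toLinearMap
  let B : E × S →ᵃ[ℝ] (Fin d → ℝ × ℝ) × S :=
    (AffineMap.pi fun i => ((h⁻¹ • fstS.comp (LinearMap.snd ℝ E S)).toAffineMap +
        AffineMap.const ℝ _ (-(n : ℝ))).prod ((coord i).comp (LinearMap.fst ℝ E S)).toAffineMap).prod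
      ((fstS.comp (LinearMap.snd ℝ E S)).prod
        ((midS.comp (LinearMap.snd ℝ E S) + h • LinearMap.fst ℝ E S).prod
          (lastS.comp (LinearMap.snd ℝ E S)))).toAffineMap
  have h2 := (((hasNet_clampMul m).piMap (ι := Fin d)).prodMap (hid (m + 2))).precomp B
  let F := Fin d → ℝ
  let D : F × S →ₗ[ℝ] S := (fstS.comp (LinearMap.snd ℝ F S)).prod
    ((midS.comp (LinearMap.snd ℝ F S)).prod (lastS.comp (LinearMap.snd ℝ F S) +
      h • (WithLp.linearEquiv 2 ℝ (Fin d → ℝ)).symm.toLinearMap.comp (LinearMap.fst ℝ F S)))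
  have h3 := ((h2.mono (w' := w + 14 * d) (by simp; omega)).comp
    (h1.mono (w' := w + 14 * d) (by omega))).postcomp D.toAffineMap
  refine h3.congr fun p => ?_
  have e : p.1 / h - n = h⁻¹ * p.1 + -(n : ℝ) := by ring
  rw [e]
  rfl

theorem hasNet_eulerApprox {d w L : ℕ} (hd : 0 < d)
    {f : EuclideanSpace ℝ (Fin d) → EuclideanSpace ℝ (Fin d)} (hf : HasNet w L f) (h : ℝ)
    (m n : ℕ) :
    HasNet (w + 14 * d) (n * (L + (m + 2)))
      (fun p : ℝ × EuclideanSpace ℝ (Fin d) =>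
        (p.1, eulerGrid f h p.2 n, eulerApprox f h m n p.1 p.2)) := by
  induction n with
  | zero =>
    rw [zero_mul]
    let E := EuclideanSpace ℝ (Fin d)
    refine (HasNet.affine ((LinearMap.fst ℝ ℝ E).prod
      ((LinearMap.snd ℝ ℝ E).prod (LinearMap.snd ℝ ℝ E))).toAffineMap).congr fun p => ?_
    simp [eulerGrid, eulerApprox]
  | succ n ih =>
    rw [Nat.add_one_mul n]
    refine ((hasNet_eulerStep hd hf h m n).comp ih).congr fun p => ?_
    simp only [eulerGrid, eulerApprox, Finset.sum_range_succ, add_assoc]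

theorem exists_reluNet_eulerApprox {d : ℕ} (hd : 0 < d) (Φ : ReLUNet d d) (h : ℝ) (m N : ℕ) :
    ∃ Ψ : ReLUNet (d + 1) d,
      Ψ.params ≤ (N * (Φ.params + (m + 2)) + 1) *
        ((Φ.params + 14 * d) * (Φ.params + 14 * d + 1)) ∧
      ∀ t x, Ψ.realization (timeSpacePoint t x) = eulerApprox Φ.realization h m N t x := by
  obtain ⟨L, hL, hΦ⟩ := Φ.exists_hasNet le_rfl
  let E := EuclideanSpace ℝ (Fin d)
  let e := (WithLp.linearEquiv 2 ℝ (Fin (d + 1) → ℝ)).toLinearMap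
  let A : EuclideanSpace ℝ (Fin (d + 1)) →ₗ[ℝ] ℝ × E :=
    ((LinearMap.proj 0).comp e).prod ((WithLp.linearEquiv 2 ℝ (Fin d → ℝ)).symm.toLinearMap.comp
      ((LinearMap.funLeft ℝ ℝ Fin.succ).comp e))
  have h1 := ((hasNet_eulerApprox hd hΦ h m N).precomp A.toAffineMap).postcomp
    ((LinearMap.snd ℝ E E).comp (LinearMap.snd ℝ ℝ (E × E))).toAffineMap
  obtain ⟨Ψ, hp, hr⟩ := ReLUNet.exists_of_hasNet (by omega) (by omega) h1
  refine ⟨Ψ, hp.trans (by gcongr), fun t x => ?_⟩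
  rw [hr]
  rfl

theorem norm_eulerApprox_le {d : ℕ}
    {f : EuclideanSpace ℝ (Fin d) → EuclideanSpace ℝ (Fin d)} {h v : ℝ} (hh : 0 ≤ h) (m n : ℕ)
    (t : ℝ) (x : EuclideanSpace ℝ (Fin d)) (hv : ∀ k < n, ‖f (eulerGrid f h x k)‖ ≤ v) :
    ‖eulerApprox f h m n t x‖ ≤ ‖x‖ + n * h * (Real.sqrt d + v) := by
  refine (norm_add_le _ _).trans ?_
  gcongr
  refine (norm_sum_le_of_le _ (n := fun _ => h * (Real.sqrt d + v)) fun k hk => ?_).trans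
    (le_of_eq ?_)
  · refine (norm_clampSMul_le m hh _ _).trans ?_
    gcongr
    exact hv k (Finset.mem_range.1 hk)
  · simp [mul_assoc]

theorem norm_sub_eulerApprox_le {d : ℕ}
    {f : EuclideanSpace ℝ (Fin d) → EuclideanSpace ℝ (Fin d)} {h v : ℝ} (hh : 0 ≤ h) (m n : ℕ)
    (t : ℝ) (x : EuclideanSpace ℝ (Fin d)) (hv : ∀ k < n, ‖f (eulerGrid f h x k)‖ ≤ v) :
    ‖x + ∑ k ∈ Finset.range n, (h * unitClamp (t / h - k)) • f (eulerGrid f h x k)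
        - eulerApprox f h m n t x‖ ≤ n * h * (1 / 2) ^ m * (Real.sqrt d + v ^ 3) := by
  rw [eulerApprox, add_sub_add_left_eq_sub, ← Finset.sum_sub_distrib]
  refine (norm_sum_le_of_le _ (n := fun _ => h * (1 / 2) ^ m * (Real.sqrt d + v ^ 3))
    fun k hk => ?_).trans (le_of_eq ?_)
  · refine (norm_smul_sub_clampSMul_le m hh _ _).trans ?_
    gcongr
    exact hv k (Finset.mem_range.1 hk)
  · simp [mul_assoc]

/-! ### Choice of the accuracy and final estimates. -/

theorem exists_half_pow_le {ε : ℝ} (h0 : 0 < ε) (h1 : ε ≤ 1) :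
    ∃ m : ℕ, (1 / 2 : ℝ) ^ m ≤ ε ∧ (m : ℝ) ≤ 2 + |Real.log ε| ^ 2 := by
  have hl2 := Real.log_two_gt_d9
  have hl : Real.log ε ≤ 0 := Real.log_nonpos h0.le h1
  set a := |Real.log ε| with ha
  have ha' : a = -Real.log ε := abs_of_nonpos hl
  -- As log 2 ≥ 1/2, the ceiling is at most 2a + 1 ≤ 2 + a².
  refine ⟨⌈a / Real.log 2⌉₊, ?_, ?_⟩
  · have h := Nat.le_ceil (a / Real.log 2)
    rw [div_le_iff₀ (by linarith)] at h
    rw [← Real.log_le_log_iff (by positivity) h0, Real.log_pow, one_div, Real.log_inv]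
    linarith
  · have h := (Nat.ceil_lt_add_one (div_nonneg (abs_nonneg (Real.log ε)) (by linarith :
      0 ≤ Real.log 2))).le
    have h2 : a / Real.log 2 ≤ 2 * a := by
      rw [div_le_iff₀ (by linarith)]
      nlinarith [abs_nonneg (Real.log ε)]
    nlinarith [sq_nonneg (a - 1)]

theorem theorem1p1
    (𝔠 T 𝔡 : ℝ) (h𝔠 : 0 < 𝔠) (hT : 0 < T) (h𝔡 : 0 < 𝔡)
    (Φ : (d : ℕ) → ReLUNet d d)
    (hΦ_growth : ∀ d : ℕ, 0 < d → ∀ x : EuclideanSpace ℝ (Fin d),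
      ‖(Φ d).realization x‖ ≤ 𝔠 * (1 + ‖x‖))
    (hΦ_params : ∀ d : ℕ, 0 < d → ((Φ d).params : ℝ) ≤ 𝔠 * (d : ℝ) ^ 𝔡)
    -- only the values `Y d N t x` with `0 < d`, `0 < N` and `t ∈ [0, T]` matter
    (Y : (d : ℕ) → (N : ℕ) → ℝ → EuclideanSpace ℝ (Fin d) → EuclideanSpace ℝ (Fin d))
    (hY_zero : ∀ d N : ℕ, 0 < d → 0 < N → ∀ x : EuclideanSpace ℝ (Fin d), Y d N 0 x = x)
    (hY_step : ∀ d N : ℕ, 0 < d → 0 < N → ∀ n : ℕ, n < N →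
      ∀ t ∈ Set.Icc ((n : ℝ) * T / (N : ℝ)) (((n : ℝ) + 1) * T / (N : ℝ)),
      ∀ x : EuclideanSpace ℝ (Fin d),
        Y d N t x = Y d N ((n : ℝ) * T / (N : ℝ)) x
          + (t - (n : ℝ) * T / (N : ℝ)) • (Φ d).realization (Y d N ((n : ℝ) * T / (N : ℝ)) x)) :
    ∃ (C : ℝ) (Ψ : (ε : ℝ) → (d : ℕ) → (N : ℕ) → ReLUNet (d + 1) d),
      ∀ ε : ℝ, 0 < ε → ε ≤ 1 → ∀ d N : ℕ, 0 < d → 0 < N →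
        Continuous (Ψ ε d N).realization ∧
        (∀ t ∈ Set.Icc (0 : ℝ) T, ∀ x : EuclideanSpace ℝ (Fin d),
          ‖Y d N t x - (Ψ ε d N).realization (timeSpacePoint t x)‖
            ≤ C * (d : ℝ) ^ (1 / 2 : ℝ) * (N : ℝ) ^ (3 / 2 : ℝ) * ε * (1 + ‖x‖ ^ 3)) ∧
        (∀ t ∈ Set.Icc (0 : ℝ) T, ∀ x : EuclideanSpace ℝ (Fin d),
          ‖(Ψ ε d N).realization (timeSpacePoint t x)‖
            ≤ C * (d : ℝ) ^ (1 / 2 : ℝ) * (N : ℝ) * (1 + ‖x‖ ^ 2)) ∧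
        ((Ψ ε d N).params : ℝ)
          ≤ C * (d : ℝ) ^ (16 + 8 * 𝔡) * (N : ℝ) ^ 6 * (1 + |Real.log ε| ^ 2) := by
  -- K(1 + ‖x‖) bounds f at all grid points used. C₁, C₂, C₃ serve the error, growth and size
  -- bounds; their sum serves all three.
  set K : ℝ := 𝔠 * Real.exp (𝔠 * T) with hK
  have hK0 : 0 < K := by positivity
  set C₁ : ℝ := T * (1 + 4 * K ^ 3)
  set C₂ : ℝ := 1 + T * (1 + 2 * K)
  set C₃ : ℝ := 2 * ((𝔠 + 5) * (𝔠 + 14) ^ 2)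
  have hC₁ : 0 ≤ C₁ := by positivity
  have hC₂ : 0 ≤ C₂ := by positivity
  have hC₃ : 0 ≤ C₃ := by positivity
  have main : ∀ (ε : ℝ) (d N : ℕ), ∃ Ψ : ReLUNet (d + 1) d, 0 < ε → ε ≤ 1 → 0 < d → 0 < N →
      ∃ m : ℕ, (1 / 2 : ℝ) ^ m ≤ ε ∧ (m : ℝ) ≤ 2 + |Real.log ε| ^ 2 ∧
      Ψ.params ≤ (N * ((Φ d).params + (m + 2)) + 1) *
        (((Φ d).params + 14 * d) * ((Φ d).params + 14 * d + 1)) ∧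
      ∀ t x, Ψ.realization (timeSpacePoint t x) =
        eulerApprox (Φ d).realization (T / N) m N t x := by
    intro ε d N
    by_cases h : 0 < ε ∧ ε ≤ 1 ∧ 0 < d
    · obtain ⟨h0, h1, hd⟩ := h
      obtain ⟨m, hm, hm'⟩ := exists_half_pow_le h0 h1
      obtain ⟨Ψ, hp, hr⟩ := exists_reluNet_eulerApprox hd (Φ d) (T / N) m N
      exact ⟨Ψ, fun _ _ _ _ => ⟨m, hm, hm', hp, hr⟩⟩
    -- Dummy network for irrelevant parameters.
    · exact ⟨.output 0 0, fun h0 h1 hd _ => (h ⟨h0, h1, hd⟩).elim⟩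
  choose Ψ hΨ using main
  refine ⟨C₁ + C₂ + C₃, Ψ, fun ε h0 h1 d N hd hN => ?_⟩
  obtain ⟨m, hm, hm', hp, hr⟩ := hΨ ε d N h0 h1 hd hN
  have hd1 : (1 : ℝ) ≤ d := by exact_mod_cast hd
  have hN1 : (1 : ℝ) ≤ N := by exact_mod_cast hN
  have hh : 0 < T / N := by positivity
  have hNh : N * (T / N) = T := by field_simp
  have hsd : (1 : ℝ) ≤ Real.sqrt d := Real.one_le_sqrt.2 hd1
  have hv : ∀ x, ∀ k < N, ‖(Φ d).realization (eulerGrid (Φ d).realization (T / N) x k)‖ ≤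
      K * (1 + ‖x‖) := by
    intro x k hk
    refine (hΦ_growth d hd _).trans ?_
    rw [hK, mul_assoc]
    gcongr
    refine (norm_eulerGrid_le hh.le (hΦ_growth d hd) x k).trans
      (mul_le_mul_of_nonneg_right (Real.exp_le_exp.2 ?_) (by positivity))
    have hkN : (k : ℝ) ≤ N := by exact_mod_cast hk.le
    calc (k : ℝ) * (𝔠 * (T / N)) ≤ N * (𝔠 * (T / N)) := by gcongr
      _ = 𝔠 * T := by field_simp
  refine ⟨(Ψ ε d N).continuous_realization, fun t ht x => ?_, fun t _ x => ?_, ?_⟩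
  · have hY : Y d N t x = x + ∑ k ∈ Finset.range N, (T / N * unitClamp (t / (T / N) - k)) •
        (Φ d).realization (eulerGrid (Φ d).realization (T / N) x k) := by
      refine euler_interpolation_eq (Y := fun t => Y d N t x) hh (hY_zero d N hd hN x)
        (fun n hn t ht => ?_) le_rfl ht.1 (ht.2.trans_eq hNh.symm)
      simp only [← mul_div_assoc] at ht ⊢
      exact hY_step d N hd hN n hn t ht x
    rw [hr, hY, ← Real.sqrt_eq_rpow]
    refine (norm_sub_eulerApprox_le hh.le m N t x (hv x)).trans ?_
    rw [hNh]
    have hx : (1 + ‖x‖) ^ 3 ≤ 4 * (1 + ‖x‖ ^ 3) := by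
      nlinarith [mul_nonneg (by positivity : 0 ≤ 1 + ‖x‖) (sq_nonneg (‖x‖ - 1))]
    have hx1 : 1 ≤ 1 + ‖x‖ ^ 3 := le_add_of_nonneg_right (by positivity)
    have hN2 : (1 : ℝ) ≤ (N : ℝ) ^ (3 / 2 : ℝ) := Real.one_le_rpow hN1 (by norm_num)
    calc T * (1 / 2) ^ m * (Real.sqrt d + (K * (1 + ‖x‖)) ^ 3)
        ≤ T * ε * (Real.sqrt d * (1 + ‖x‖ ^ 3) +
            Real.sqrt d * (K ^ 3 * (4 * (1 + ‖x‖ ^ 3)))) := by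
          rw [mul_pow]
          refine mul_le_mul (by gcongr) (add_le_add ?_ ?_) (by positivity) (by positivity)
          · exact le_mul_of_one_le_right (by positivity) hx1
          · exact (mul_le_mul_of_nonneg_left hx (by positivity)).trans
              (le_mul_of_one_le_left (by positivity) hsd)
      _ = C₁ * Real.sqrt d * 1 * ε * (1 + ‖x‖ ^ 3) := by ring
      _ ≤ (C₁ + C₂ + C₃) * Real.sqrt d * (N : ℝ) ^ (3 / 2 : ℝ) * ε * (1 + ‖x‖ ^ 3) := by
          gcongr
          linarith
  · rw [hr, ← Real.sqrt_eq_rpow]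
    refine (norm_eulerApprox_le hh.le m N t x (hv x)).trans ?_
    rw [hNh]
    have hx : ‖x‖ ≤ 1 + ‖x‖ ^ 2 := by nlinarith [sq_nonneg (‖x‖ - 1), norm_nonneg x]
    have hx' : 1 + ‖x‖ ≤ 2 * (1 + ‖x‖ ^ 2) := by nlinarith [sq_nonneg ‖x‖]
    have hx1 : 1 ≤ 1 + ‖x‖ ^ 2 := le_add_of_nonneg_right (by positivity)
    calc ‖x‖ + T * (Real.sqrt d + K * (1 + ‖x‖))
        ≤ Real.sqrt d * (1 + ‖x‖ ^ 2) + T * (Real.sqrt d * (1 + ‖x‖ ^ 2) +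
            Real.sqrt d * (K * (2 * (1 + ‖x‖ ^ 2)))) := by
          refine add_le_add ?_ (mul_le_mul_of_nonneg_left (add_le_add ?_ ?_) hT.le)
          · exact hx.trans (le_mul_of_one_le_left (by positivity) hsd)
          · exact le_mul_of_one_le_right (by positivity) hx1
          · exact (mul_le_mul_of_nonneg_left hx' (by positivity)).trans
              (le_mul_of_one_le_left (by positivity) hsd)
      _ = C₂ * Real.sqrt d * 1 * (1 + ‖x‖ ^ 2) := by ring
      _ ≤ (C₁ + C₂ + C₃) * Real.sqrt d * N * (1 + ‖x‖ ^ 2) := by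
          gcongr
          linarith
  · have hP := hΦ_params d hd
    have hp' : ((Ψ ε d N).params : ℝ) ≤ (N * ((Φ d).params + (m + 2)) + 1) *
        (((Φ d).params + 14 * d) * ((Φ d).params + 14 * d + 1)) := by exact_mod_cast hp
    have hD1 : (1 : ℝ) ≤ (d : ℝ) ^ 𝔡 := Real.one_le_rpow hd1 h𝔡.le
    have hpow : (d : ℝ) ^ (16 + 8 * 𝔡) = (d : ℝ) ^ 16 * ((d : ℝ) ^ 𝔡) ^ 8 := by
      rw [Real.rpow_add (by positivity), mul_comm 8 𝔡, Real.rpow_mul (by positivity)]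
      norm_cast
    rw [hpow]
    generalize (d : ℝ) ^ 𝔡 = D at *
    set l : ℝ := 1 + |Real.log ε| ^ 2 with hl
    have hl1 : 1 ≤ l := le_add_of_nonneg_right (by positivity)
    have hW : ((Φ d).params : ℝ) + 14 * d ≤ (𝔠 + 14) * (d * D) := by
      have e1 : 𝔠 * D ≤ 𝔠 * (d * D) := by
        gcongr
        exact le_mul_of_one_le_left (by positivity) hd1
      have e2 : (d : ℝ) ≤ d * D := le_mul_of_one_le_right (by positivity) hD1
      linarith
    have hW1 : (1 : ℝ) ≤ (Φ d).params + 14 * d := by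
      have : (0 : ℝ) ≤ (Φ d).params := by positivity
      linarith
    have hL : ((Φ d).params : ℝ) + (m + 2) + 1 ≤ (𝔠 + 5) * (D * l) := by
      have e1 : 𝔠 * D ≤ 𝔠 * (D * l) := by
        gcongr
        exact le_mul_of_one_le_right (by positivity) hl1
      have e2 : l ≤ D * l := le_mul_of_one_le_left (by positivity) hD1
      linarith
    calc ((Ψ ε d N).params : ℝ) ≤ _ := hp'
      -- The extra 1 of the depth is absorbed using N ≥ 1, that of the width using width at least 1.
      _ ≤ (N * ((Φ d).params + (m + 2) + 1)) *
          (((Φ d).params + 14 * d) * (2 * ((Φ d).params + 14 * d))) := by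
          gcongr
          · linarith
          · linarith
      _ ≤ (N * ((𝔠 + 5) * (D * l))) *
          (((𝔠 + 14) * (d * D)) * (2 * ((𝔠 + 14) * (d * D)))) := by gcongr
      _ = C₃ * ((d : ℝ) ^ 2 * D ^ 3) * (N : ℝ) ^ 1 * l := by ring
      -- The construction needs only d² D³ N, far below the allowed powers.
      _ ≤ (C₁ + C₂ + C₃) * ((d : ℝ) ^ 16 * D ^ 8) * (N : ℝ) ^ 6 * l := by
          gcongr
          · linarith
          · norm_num
          · norm_num
          · norm_num
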